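/- Let $n,m\ge 1$ be integers. For $\mathbb K\in\{\mathbb R,\mathbb C\}$ let $M_n(\mathbb K)$ denote the $n\times n$ matrices over $\mathbb K$, equipped with the Hilbert–Schmidt scalar product $\langle X,Y\rangle=\operatorname{Tr}(X^*Y)$. Call a $\mathbb K$-linear map $\Phi:M_n(\mathbb K)\to M_m(\mathbb K)$ strictly positive if $\Phi(X)$ is positive definite for every nonzero (self-adjoint) positive semidefinite $X\in M_n(\mathbb K)$. Let $\Phi^*:M_m(\mathbb K)\to M_n(\mathbb K)$ be its Hilbert–Schmidt adjoint, determined by $\langle\Phi(X),Y\rangle=\langle X,\Phi^*(Y)\rangle$ for all $X\in M_n(\mathbb K)$, $Y\in M_m(\mathbb K)$. Let $\Phi:M_n(\mathbb K)\to M_m(\mathbb K)$ be a strictly positive linear map; if $\mathbb K=\mathbb R$, assume in addition that $\Phi(X^{\mathrm T})=\Phi(X)^{\mathrm T}$ for all $X$ (for $\mathbb K=\mathbb C$ the corresponding property $\Phi(X^*)=\Phi(X)^*$ is automatic). Then there exist positive definite matrices $\varphi_0\in M_n(\mathbb K)$ and $\varphi_1\in M_m(\mathbb K)$ such that $$\Phi(\varphi_0^{-1})=\frac1m\,\varphi_1^{-1},\qquad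 \Phi^*(\varphi_1)=\frac1n\,\varphi_0,$$ and the pair is unique up to a common positive multiplicative constant: a pair of positive definite matrices $(\psi_0,\psi_1)\in M_n(\mathbb K)\times M_m(\mathbb K)$ satisfies the same two equations if and only if $(\psi_0,\psi_1)=(c\,\varphi_0,c\,\varphi_1)$ for some real $c>0$. -/

import Mathlib

open scoped ComplexOrder Matrix

namespace OperatorScaling

noncomputable section

/-- `Φ` is strictly positive (positivity improving): it sends every nonzero positive semidefinite
matrix to a positive definite one. -/
def StrictlyPositive {𝕜 : Type*} [RCLike 𝕜] {n m : ℕ}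
    (Φ : Matrix (Fin n) (Fin n) 𝕜 →ₗ[𝕜] Matrix (Fin m) (Fin m) 𝕜) : Prop :=
  ∀ X : Matrix (Fin n) (Fin n) 𝕜, X.PosSemidef → X ≠ 0 → (Φ X).PosDef

/-- The Hilbert–Schmidt scalar product `⟨X, Y⟩ = Tr (X* Y)`. -/
def hsInner {𝕜 : Type*} [RCLike 𝕜] {n : ℕ} (X Y : Matrix (Fin n) (Fin n) 𝕜) : 𝕜 :=
  (Xᴴ * Y).trace

/-- The Hilbert–Schmidt adjoint `Φ*`, given by its entries `Φ*(Y)ᵢⱼ = ⟨Φ(Eᵢⱼ), Y⟩`, where `Eᵢⱼ` are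
the matrix units. It is characterized by `hsInner_map_eq` and `eq_hsAdjoint`. -/
def hsAdjoint {𝕜 : Type*} [RCLike 𝕜] {n m : ℕ}
    (Φ : Matrix (Fin n) (Fin n) 𝕜 →ₗ[𝕜] Matrix (Fin m) (Fin m) 𝕜) :
    Matrix (Fin m) (Fin m) 𝕜 →ₗ[𝕜] Matrix (Fin n) (Fin n) 𝕜 where
  toFun Y := Matrix.of fun i j => hsInner (Φ (Matrix.single i j 1)) Y
  map_add' Y Z := by
    ext i j
    simp [hsInner, Matrix.mul_add]
  map_smul' c Y := by
    ext i j
    simp [hsInner]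

theorem hsInner_single {𝕜 : Type*} [RCLike 𝕜] {n : ℕ} (i j : Fin n)
    (Z : Matrix (Fin n) (Fin n) 𝕜) : hsInner (Matrix.single i j 1) Z = Z i j := by
  simp [hsInner, Matrix.conjTranspose_single, Matrix.trace_single_mul]

/-- The defining equation `⟨Φ(X), Y⟩ = ⟨X, Φ*(Y)⟩` of the adjoint. -/
theorem hsInner_map_eq {𝕜 : Type*} [RCLike 𝕜] {n m : ℕ}
    (Φ : Matrix (Fin n) (Fin n) 𝕜 →ₗ[𝕜] Matrix (Fin m) (Fin m) 𝕜)
    (X : Matrix (Fin n) (Fin n) 𝕜) (Y : Matrix (Fin m) (Fin m) 𝕜) :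
    hsInner (Φ X) Y = hsInner X (hsAdjoint Φ Y) := by
  induction X using Matrix.induction_on' with
  | h_zero => simp [hsInner]
  | h_add p q hp hq =>
    simp only [hsInner, map_add, Matrix.conjTranspose_add, Matrix.add_mul,
      Matrix.trace_add] at hp hq ⊢
    rw [hp, hq]
  | h_std_basis i j x =>
    have h : Matrix.single i j x = x • Matrix.single i j (1 : 𝕜) := by simp
    have h2 : hsInner (Matrix.single i j 1) (hsAdjoint Φ Y)
        = hsInner (Φ (Matrix.single i j 1)) Y := hsInner_single i j _
    rw [h, map_smul]
    simp only [hsInner, Matrix.conjTranspose_smul, Matrix.smul_mul, Matrix.trace_smul] at h2 ⊢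
    rw [h2]

/-- The defining equation determines the adjoint. -/
theorem eq_hsAdjoint {𝕜 : Type*} [RCLike 𝕜] {n m : ℕ}
    (Φ : Matrix (Fin n) (Fin n) 𝕜 →ₗ[𝕜] Matrix (Fin m) (Fin m) 𝕜)
    (Ψ : Matrix (Fin m) (Fin m) 𝕜 →ₗ[𝕜] Matrix (Fin n) (Fin n) 𝕜)
    (h : ∀ X Y, hsInner (Φ X) Y = hsInner X (Ψ Y)) : Ψ = hsAdjoint Φ := by
  ext1 Y
  ext i j
  rw [← hsInner_single i j (Ψ Y), ← h]
  rfl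

/-- The pair `(φ₀, φ₁)` of positive definite matrices scales `Φ`:
`Φ(φ₀⁻¹) = (1/m) φ₁⁻¹` and `Φ*(φ₁) = (1/n) φ₀`. -/
def IsScalingPair {𝕜 : Type*} [RCLike 𝕜] {n m : ℕ}
    (Φ : Matrix (Fin n) (Fin n) 𝕜 →ₗ[𝕜] Matrix (Fin m) (Fin m) 𝕜)
    (φ₀ : Matrix (Fin n) (Fin n) 𝕜) (φ₁ : Matrix (Fin m) (Fin m) 𝕜) : Prop :=
  φ₀.PosDef ∧ φ₁.PosDef ∧
    Φ φ₀⁻¹ = (1 / (m : 𝕜)) • φ₁⁻¹ ∧ hsAdjoint Φ φ₁ = (1 / (n : 𝕜)) • φ₀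

end

end OperatorScaling

/-! Existence is variational. The quotient `det X ^ m / det (Φ X) ^ n` is invariant under scaling of
`X`, so it may be maximized over positive semidefinite `X` of trace one. This set is compact, and
strict positivity keeps the denominator nonzero even at singular `X`, where the numerator vanishes;
hence the maximum is attained at a positive definite `X`. By Jacobi's formula its critical equation
is `m X⁻¹ = n Φ*((Φ X)⁻¹)`, which is the scaling system for `φ₀ = X⁻¹`, `φ₁ = (1/m) (Φ X)⁻¹`.

Uniqueness is a Perron–Frobenius argument. Inversion reverses the strict Loewner order, while `Φ`
and `Φ*` send nonzero positive semidefinite differences to definite ones. So one round through the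
scaling equations improves `≤` to `<` unless equality holds, which contradicts the choice of the
largest `c` with `c ψ₀⁻¹ ≤ φ₀⁻¹`. -/

namespace OperatorScaling

open Matrix Filter Topology

/-! ### Positive definite matrices: traces, Loewner order, determinants. -/

section MatrixLemmas

variable {𝕜 ι : Type*} [RCLike 𝕜] [Fintype ι]

/-- A positive semidefinite matrix is of the form `Bᴴ * B`. -/
theorem exists_eq_conjTranspose_mul_self [DecidableEq ι] {A : Matrix ι ι 𝕜} (hA : A.PosSemidef) :
    ∃ B : Matrix ι ι 𝕜, A = Bᴴ * B := by
  open scoped MatrixOrder Matrix.Norms.L2Operator in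
  exact CStarAlgebra.nonneg_iff_eq_star_mul_self.mp hA.nonneg

theorem trace_mul_nonneg {P Z : Matrix ι ι 𝕜} (hP : P.PosSemidef) (hZ : Z.PosSemidef) :
    0 ≤ (P * Z).trace := by
  classical
  obtain ⟨B, rfl⟩ := exists_eq_conjTranspose_mul_self hZ
  rw [← Matrix.mul_assoc, Matrix.trace_mul_comm, ← Matrix.mul_assoc]
  exact (hP.mul_mul_conjTranspose_same B).trace_nonneg

/-- With `P = Cᴴ * C` and `Z = Bᴴ * B`, the trace is the squared Hilbert–Schmidt norm of `C * Bᴴ`.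
If it vanishes, then `P * Bᴴ = 0`, and `P` is invertible. -/
theorem trace_mul_pos {P Z : Matrix ι ι 𝕜} (hP : P.PosDef) (hZ : Z.PosSemidef) (hZ0 : Z ≠ 0) :
    0 < (P * Z).trace := by
  classical
  refine lt_of_le_of_ne (trace_mul_nonneg hP.posSemidef hZ) fun h => hZ0 ?_
  obtain ⟨B, rfl⟩ := exists_eq_conjTranspose_mul_self hZ
  obtain ⟨C, hC⟩ := exists_eq_conjTranspose_mul_self hP.posSemidef
  have h1 : ((C * Bᴴ)ᴴ * (C * Bᴴ)).trace = 0 := by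
    rw [h, hC, ← Matrix.mul_assoc (Cᴴ * C) Bᴴ B, Matrix.trace_mul_comm (Cᴴ * C * Bᴴ)]
    simp [Matrix.mul_assoc]
  rw [trace_conjTranspose_mul_self_eq_zero_iff] at h1
  have h2 : P * Bᴴ = 0 := by rw [hC, Matrix.mul_assoc, h1, Matrix.mul_zero]
  rw [hP.isUnit.mul_right_eq_zero.mp h2, Matrix.zero_mul]

theorem isHermitian_real_smul {κ : Type*} {H : Matrix κ κ 𝕜} (hH : H.IsHermitian) (t : ℝ) :
    (t • H).IsHermitian := by
  rw [IsHermitian, conjTranspose_smul, hH.eq, star_trivial]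

/-- Positive definiteness is stable under small Hermitian perturbations. -/
theorem eventually_posDef_add_smul {A H : Matrix ι ι 𝕜} (hA : A.PosDef) (hH : H.IsHermitian) :
    ∀ᶠ t : ℝ in 𝓝 0, (A + t • H).PosDef := by
  have herm : ∀ t : ℝ, (A + t • H).IsHermitian := fun t =>
    hA.1.add (isHermitian_real_smul hH t)
  -- Compactness of the unit sphere gives one neighbourhood of `t = 0` that serves all directions;
  -- homogeneity then covers every nonzero `x`.
  have key : ∀ᶠ t : ℝ in 𝓝 0, ∀ x ∈ Metric.sphere (0 : ι → 𝕜) 1,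
      0 < RCLike.re (star x ⬝ᵥ ((A + t • H) *ᵥ x)) := by
    refine (isCompact_sphere (0 : ι → 𝕜) 1).eventually_forall_of_forall_eventually fun x hx => ?_
    have hx0 : x ≠ 0 := ne_zero_of_mem_unit_sphere ⟨x, hx⟩
    have hcont : Continuous fun z : ℝ × (ι → 𝕜) =>
        RCLike.re (star z.2 ⬝ᵥ ((A + z.1 • H) *ᵥ z.2)) := by fun_prop
    refine hcont.continuousAt.eventually_const_lt ?_
    simpa using hA.re_dotProduct_pos hx0
  filter_upwards [key] with t ht
  refine .of_dotProduct_mulVec_pos (herm t) fun x hx => ?_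
  have hn : 0 < ‖x‖ := norm_pos_iff.mpr hx
  have h1 := ht (((‖x‖⁻¹ : ℝ) : 𝕜) • x) (by
    rw [mem_sphere_zero_iff_norm, norm_smul, RCLike.norm_ofReal, abs_of_pos (inv_pos.mpr hn),
      inv_mul_cancel₀ hn.ne'])
  rw [mulVec_smul, star_smul, smul_dotProduct, dotProduct_smul, RCLike.star_def, RCLike.conj_ofReal,
    smul_smul, smul_eq_mul, ← RCLike.ofReal_mul, RCLike.re_ofReal_mul] at h1
  have him : RCLike.im (star x ⬝ᵥ ((A + t • H) *ᵥ x)) = 0 := (herm t).im_star_dotProduct_mulVec_self x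
  rw [RCLike.pos_iff]
  exact ⟨(mul_pos_iff_of_pos_left (by positivity)).mp h1, him⟩

/-- Inversion reverses the strict Loewner order. -/
theorem posDef_inv_sub_inv [DecidableEq ι] {A B : Matrix ι ι 𝕜} (hB : B.PosDef)
    (hAB : (A - B).PosDef) : (B⁻¹ - A⁻¹).PosDef := by
  have hA : A.PosDef := by simpa using hAB.add hB
  let := hA.isUnit.invertible
  let := hB.inv.isUnit.invertible
  have hAd := (isUnit_iff_isUnit_det A).mp hA.isUnit
  have hBd := (isUnit_iff_isUnit_det B).mp hB.isUnit
  -- `A - B` and `B⁻¹ - A⁻¹` are the two Schur complements of the block matrix with rows `(A, 1)`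
  -- and `(1, B⁻¹)`, so semidefiniteness passes from one to the other; invertibility then gives
  -- strictness.
  have h1 := PosDef.fromBlocks₁₁ (1 : Matrix ι ι 𝕜) B⁻¹ hA
  have h2 := PosDef.fromBlocks₂₂ A (1 : Matrix ι ι 𝕜) hB.inv
  simp only [conjTranspose_one, Matrix.one_mul, Matrix.mul_one, nonsing_inv_nonsing_inv B hBd]
    at h1 h2
  refine (h1.mp (h2.mpr hAB.posSemidef)).posDef_iff_isUnit.mpr ?_
  have h3 : B⁻¹ - A⁻¹ = B⁻¹ * (A - B) * A⁻¹ := by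
    rw [Matrix.mul_sub, Matrix.sub_mul, nonsing_inv_mul B hBd, Matrix.one_mul, Matrix.mul_assoc,
      mul_nonsing_inv A hAd, Matrix.mul_one]
  rw [h3]
  exact (hB.inv.isUnit.mul hAB.isUnit).mul hA.inv.isUnit

/-- Jacobi's formula at an invertible matrix. -/
theorem hasDerivAt_re_det_add_smul [DecidableEq ι] {A H : Matrix ι ι 𝕜} (hA : A.PosDef) :
    HasDerivAt (fun t : ℝ => RCLike.re (A + t • H).det)
      (RCLike.re A.det * RCLike.re (A⁻¹ * H).trace) 0 := by
  have hAd := (isUnit_iff_isUnit_det A).mp hA.isUnit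
  set M := A⁻¹ * H
  -- The second-order remainder in `det (1 + t M) = 1 + t tr M + t² q(t)`.
  set q : Polynomial 𝕜 :=
    (det (1 + (Polynomial.X : Polynomial 𝕜) • M.map Polynomial.C)).divX.divX
  have hdet : ∀ t : ℝ, (A + t • H).det =
      A.det * (1 + M.trace * (t : 𝕜) + q.eval (t : 𝕜) * (t : 𝕜) ^ 2) := by
    intro t
    have : A + t • H = A * (1 + (t : 𝕜) • M) := by
      rw [Matrix.mul_add, Matrix.mul_one, Matrix.mul_smul, ← Matrix.mul_assoc,
        mul_nonsing_inv A hAd, Matrix.one_mul, RCLike.real_smul_eq_coe_smul (K := 𝕜)]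
    rw [this, det_mul, det_one_add_smul]
  have h1 : HasDerivAt (fun s : 𝕜 => A.det * (1 + M.trace * s + q.eval s * s ^ 2))
      (A.det * M.trace) 0 := by
    have := ((((hasDerivAt_id (0 : 𝕜)).const_mul M.trace).const_add 1).add
      ((q.hasDerivAt 0).mul ((hasDerivAt_id (0 : 𝕜)).pow 2))).const_mul A.det
    simpa using this
  have h2 : HasDerivAt (fun t : ℝ => (A + t • H).det) (A.det * M.trace) 0 := by
    simp_rw [hdet]
    have h0 : HasDerivAt (fun t : ℝ => (t : 𝕜)) 1 0 := by
      simpa using (RCLike.ofRealCLM (K := 𝕜)).hasDerivAt (x := (0 : ℝ))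
    have h1' : HasDerivAt (fun s : 𝕜 => A.det * (1 + M.trace * s + q.eval s * s ^ 2))
      (A.det * M.trace) (((0 : ℝ) : 𝕜)) := by simpa using h1
    simpa [Function.comp_def] using h1'.comp (0 : ℝ) h0
  have h3 := (RCLike.reCLM (K := 𝕜)).hasFDerivAt.comp_hasDerivAt (0 : ℝ) h2
  have him : RCLike.im A.det = 0 := (RCLike.pos_iff.mp hA.det_pos).2
  simpa [RCLike.mul_re, him, Function.comp_def] using h3

end MatrixLemmas

/-! ### The adjoint and preservation of Hermitian matrices. -/

section Scaling

variable {𝕜 : Type*} [RCLike 𝕜] {n m : ℕ}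
  {Φ : Matrix (Fin n) (Fin n) 𝕜 →ₗ[𝕜] Matrix (Fin m) (Fin m) 𝕜}

theorem conjTranspose_hsAdjoint (hΦs : ∀ X, Φ Xᴴ = (Φ X)ᴴ) (Z : Matrix (Fin m) (Fin m) 𝕜) :
    (hsAdjoint Φ Z)ᴴ = hsAdjoint Φ Zᴴ := by
  ext i j
  change star ((Φ (Matrix.single j i 1))ᴴ * Z).trace = ((Φ (Matrix.single i j 1))ᴴ * Zᴴ).trace
  rw [← trace_conjTranspose, conjTranspose_mul, conjTranspose_conjTranspose, trace_mul_comm,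
    ← hΦs, conjTranspose_single, star_one]

/-- The adjoint of a strictly positive Hermiticity-preserving map is strictly positive. -/
theorem strictlyPositive_hsAdjoint (hΦ : StrictlyPositive Φ) (hΦs : ∀ X, Φ Xᴴ = (Φ X)ᴴ) :
    StrictlyPositive (hsAdjoint Φ) := by
  intro Z hZ hZ0
  refine .of_dotProduct_mulVec_pos ?_ fun x hx => ?_
  · rw [IsHermitian, conjTranspose_hsAdjoint hΦs, hZ.1.eq]
  -- The quadratic form of `Φ*(Z)` at `x` equals `Tr (Φ(x x*) Z)`.
  · have hP := posSemidef_vecMulVec_self_star x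
    have hP0 : vecMulVec x (star x) ≠ 0 := by
      simpa [vecMulVec_eq_zero] using hx
    have h1 := trace_mul_pos (hΦ _ hP hP0) hZ hZ0
    have h2 := hsInner_map_eq Φ (vecMulVec x (star x)) Z
    rw [hsInner, hsInner, (hΦ _ hP hP0).1.eq, hP.1.eq] at h2
    rw [h2, trace_mul_comm, mul_vecMulVec, trace_vecMulVec, dotProduct_comm] at h1
    exact h1

/-- For small `t > 0` the matrix `1 + t H` is positive definite, so `H` is a real multiple of a
difference of positive semidefinite matrices. -/
theorem StrictlyPositive.isHermitian_map (hΦ : StrictlyPositive Φ)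
    {H : Matrix (Fin n) (Fin n) 𝕜} (hH : H.IsHermitian) : (Φ H).IsHermitian := by
  have hpsd : ∀ {A : Matrix (Fin n) (Fin n) 𝕜}, A.PosSemidef → (Φ A).IsHermitian := by
    intro A hA
    by_cases h0 : A = 0
    · simp [h0]
    · exact (hΦ A hA h0).1
  obtain ⟨t, h1, h2⟩ := (((eventually_posDef_add_smul PosDef.one hH).filter_mono
    nhdsWithin_le_nhds).and (self_mem_nhdsWithin : Set.Ioi (0 : ℝ) ∈ 𝓝[>] 0)).exists
  have ht : (0 : ℝ) < t := h2
  have h3 : H = t⁻¹ • ((1 + t • H) - 1) := by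
    rw [add_sub_cancel_left, inv_smul_smul₀ ht.ne']
  rw [h3, LinearMap.map_smul_of_tower, map_sub]
  exact isHermitian_real_smul ((hpsd h1.posSemidef).sub (hpsd PosSemidef.one)) _

/-! ### Existence: maximizing the determinant quotient. -/

theorem re_trace_conjTranspose_mul_self (B : Matrix (Fin n) (Fin n) 𝕜) :
    RCLike.re (Bᴴ * B).trace = ∑ i, ∑ j, ‖B j i‖ ^ 2 := by
  simp only [Matrix.trace, diag_apply, Matrix.mul_apply, conjTranspose_apply, RCLike.star_def,
    RCLike.conj_mul, ← RCLike.ofReal_pow, map_sum, RCLike.ofReal_re]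

/-- The trace is the sum of the squared entries of `B`, so each entry lies in the unit disc. Writing
trace-one semidefinite matrices as `Bᴴ * B` builds positivity into the parametrization. -/
theorem isCompact_re_trace_conjTranspose_mul_self_eq_one :
    IsCompact {B : Matrix (Fin n) (Fin n) 𝕜 | RCLike.re (Bᴴ * B).trace = 1} := by
  have hc : IsCompact (Set.univ.pi fun _ : Fin n => Set.univ.pi fun _ : Fin n =>
      Metric.closedBall (0 : 𝕜) 1) :=
    isCompact_univ_pi fun _ => isCompact_univ_pi fun _ => isCompact_closedBall _ _
  refine hc.of_isClosed_subset (isClosed_eq (by fun_prop) continuous_const) fun B hB i _ j _ => ?_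
  replace hB : ∑ l, ∑ k, ‖B k l‖ ^ 2 = 1 :=
    (re_trace_conjTranspose_mul_self B).symm.trans hB
  rw [mem_closedBall_zero_iff]
  have h1 : ‖B i j‖ ^ 2 ≤ 1 := by
    rw [← hB]
    refine (Finset.single_le_sum (f := fun k => ‖B k j‖ ^ 2) (fun _ _ => sq_nonneg _)
      (Finset.mem_univ i)).trans ?_
    exact Finset.single_le_sum (f := fun l => ∑ k, ‖B k l‖ ^ 2)
      (fun _ _ => Finset.sum_nonneg fun _ _ => sq_nonneg _) (Finset.mem_univ j)
  exact (sq_le_one_iff₀ (norm_nonneg _)).mp h1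

theorem exists_eq_smul_conjTranspose_mul_self (hn : 0 < n) {Y : Matrix (Fin n) (Fin n) 𝕜}
    (hY : Y.PosDef) : ∃ (s : ℝ) (B : Matrix (Fin n) (Fin n) 𝕜), 0 < s ∧
      RCLike.re (Bᴴ * B).trace = 1 ∧ Y = s • (Bᴴ * B) := by
  have : Nonempty (Fin n) := ⟨⟨0, hn⟩⟩
  have hs : 0 < RCLike.re Y.trace := (RCLike.pos_iff.mp hY.trace_pos).1
  obtain ⟨B, hB⟩ := exists_eq_conjTranspose_mul_self
    (hY.posSemidef.smul (inv_pos.mpr hs).le)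
  refine ⟨RCLike.re Y.trace, B, hs, ?_, ?_⟩
  · rw [← hB, trace_smul, RCLike.smul_re, inv_mul_cancel₀ hs.ne']
  · rw [← hB, smul_smul, mul_inv_cancel₀ hs.ne', one_smul]

theorem re_det_smul (s : ℝ) (A : Matrix (Fin n) (Fin n) 𝕜) :
    RCLike.re (s • A).det = s ^ n * RCLike.re A.det := by
  rw [RCLike.real_smul_eq_coe_smul (K := 𝕜), det_smul, Fintype.card_fin, ← RCLike.ofReal_pow,
    RCLike.re_ofReal_mul]

/-- The scale-invariant functional `det X ^ m / det (Φ X) ^ n` attains its maximum on the cone of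
positive definite matrices. -/
theorem StrictlyPositive.exists_isMax (hΦ : StrictlyPositive Φ) (hn : 0 < n) (hm : 0 < m) :
    ∃ X : Matrix (Fin n) (Fin n) 𝕜, X.PosDef ∧ ∀ Y : Matrix (Fin n) (Fin n) 𝕜, Y.PosDef →
      RCLike.re Y.det ^ m * RCLike.re (Φ X).det ^ n ≤
        RCLike.re X.det ^ m * RCLike.re (Φ Y).det ^ n := by
  have : Nonempty (Fin n) := ⟨⟨0, hn⟩⟩
  set K := {B : Matrix (Fin n) (Fin n) 𝕜 | RCLike.re (Bᴴ * B).trace = 1}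
  have hpos : ∀ B ∈ K, 0 < RCLike.re (Φ (Bᴴ * B)).det := by
    intro B hB
    refine (RCLike.pos_iff.mp (hΦ _ (posSemidef_conjTranspose_mul_self B) fun h0 => ?_).det_pos).1
    have hB' : RCLike.re (Bᴴ * B).trace = 1 := hB
    simp [h0] at hB'
  set f : Matrix (Fin n) (Fin n) 𝕜 → ℝ := fun B =>
    RCLike.re (Bᴴ * B).det ^ m / RCLike.re (Φ (Bᴴ * B)).det ^ n
  have hΦc : Continuous Φ := Φ.continuous_of_finiteDimensional
  have hf : ContinuousOn f K :=
    ContinuousOn.div (by fun_prop) (by fun_prop) fun B hB => (pow_pos (hpos B hB) n).ne'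
  -- The normalized identity shows that the maximum is positive, which forces the maximizer to be
  -- nonsingular.
  obtain ⟨s₁, B₁, hs₁, hB₁, h₁⟩ :=
    exists_eq_smul_conjTranspose_mul_self (𝕜 := 𝕜) hn PosDef.one
  obtain ⟨B, hB, hmax⟩ := isCompact_re_trace_conjTranspose_mul_self_eq_one.exists_isMaxOn
    ⟨B₁, hB₁⟩ hf
  have hdet₁ : 0 < RCLike.re (B₁ᴴ * B₁).det := by
    have := re_det_smul s₁ (B₁ᴴ * B₁)
    rw [← h₁, det_one, RCLike.one_re] at this
    exact (mul_pos_iff_of_pos_left (pow_pos hs₁ n)).mp (this ▸ one_pos)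
  have hfB : 0 < f B := lt_of_lt_of_le
    (div_pos (pow_pos hdet₁ m) (pow_pos (hpos B₁ hB₁) n)) (hmax hB₁)
  have hPD : (Bᴴ * B).PosDef := by
    refine (posSemidef_conjTranspose_mul_self B).posDef_iff_det_ne_zero.mpr fun h0 => hfB.ne' ?_
    simp only [f]
    rw [h0, map_zero, zero_pow hm.ne', zero_div]
  refine ⟨Bᴴ * B, hPD, fun Y hY => ?_⟩
  obtain ⟨s, C, hs, hC, rfl⟩ := exists_eq_smul_conjTranspose_mul_self hn hY
  have hle : f C ≤ f B := hmax hC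
  rw [div_le_div_iff₀ (pow_pos (hpos C hC) n) (pow_pos (hpos B hB) n)] at hle
  -- Both sides are homogeneous in `s` of degree `n * m`.
  rw [LinearMap.map_smul_of_tower, re_det_smul, re_det_smul, mul_pow, mul_pow, ← pow_mul, ← pow_mul,
    mul_comm m n]
  have := mul_le_mul_of_nonneg_left hle (pow_pos hs (n * m)).le
  linarith

/-- First-order optimality condition for a maximizer of `det X ^ m / det (Φ X) ^ n`. -/
theorem re_trace_eq_of_isMax {X : Matrix (Fin n) (Fin n) 𝕜} (hX : X.PosDef) (hX' : (Φ X).PosDef)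
    (hmax : ∀ Y : Matrix (Fin n) (Fin n) 𝕜, Y.PosDef →
      RCLike.re Y.det ^ m * RCLike.re (Φ X).det ^ n ≤
        RCLike.re X.det ^ m * RCLike.re (Φ Y).det ^ n)
    {H : Matrix (Fin n) (Fin n) 𝕜} (hH : H.IsHermitian) :
    (m : ℝ) * RCLike.re (X⁻¹ * H).trace = n * RCLike.re ((Φ X)⁻¹ * Φ H).trace := by
  have hd₀ : 0 < RCLike.re X.det := (RCLike.pos_iff.mp hX.det_pos).1
  have hd₁ : 0 < RCLike.re (Φ X).det := (RCLike.pos_iff.mp hX'.det_pos).1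
  -- The maximality inequality with denominators cleared: `p` vanishes at `0` and is nonnegative
  -- nearby.
  set p : ℝ → ℝ := fun t => RCLike.re X.det ^ m * RCLike.re (Φ X + t • Φ H).det ^ n -
    RCLike.re (X + t • H).det ^ m * RCLike.re (Φ X).det ^ n
  have hmin : IsLocalMin p 0 := by
    filter_upwards [eventually_posDef_add_smul hX hH] with t ht
    have h := hmax _ ht
    rw [map_add, LinearMap.map_smul_of_tower] at h
    simp only [p, zero_smul, add_zero, sub_self]
    exact sub_nonneg.mpr h
  have hder := (((hasDerivAt_re_det_add_smul (H := Φ H) hX').pow n).const_mul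
    (RCLike.re X.det ^ m)).sub
    (((hasDerivAt_re_det_add_smul (H := H) hX).pow m).mul_const (RCLike.re (Φ X).det ^ n))
  have h0 := hmin.hasDerivAt_eq_zero hder
  simp only [zero_smul, add_zero] at h0
  -- The truncated exponent `k - 1` is harmless at `k = 0`, where the factor `k` vanishes.
  have hpow : ∀ (k : ℕ) (d : ℝ) (τ : ℝ), (k : ℝ) * d ^ (k - 1) * (d * τ) = d ^ k * (k * τ) := by
    intro k d τ
    rcases k with _ | k
    · simp
    · rw [Nat.add_sub_cancel]; ring
  rw [hpow, hpow] at h0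
  have hne : RCLike.re X.det ^ m * RCLike.re (Φ X).det ^ n ≠ 0 := by positivity
  refine mul_left_cancel₀ hne ?_
  linarith

theorem real_smul_inv {c : ℝ} (hc : 0 < c) {A : Matrix (Fin n) (Fin n) 𝕜} (hA : A.PosDef) :
    (c • A)⁻¹ = c⁻¹ • A⁻¹ := by
  have hAd := (isUnit_iff_isUnit_det A).mp hA.isUnit
  refine inv_eq_right_inv ?_
  rw [Matrix.smul_mul, Matrix.mul_smul, smul_smul, mul_inv_cancel₀ hc.ne', one_smul,
    mul_nonsing_inv A hAd]

theorem StrictlyPositive.exists_isScalingPair (hΦ : StrictlyPositive Φ)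
    (hΦs : ∀ X, Φ Xᴴ = (Φ X)ᴴ) (hn : 0 < n) (hm : 0 < m) :
    ∃ φ₀ φ₁, IsScalingPair Φ φ₀ φ₁ := by
  have : Nonempty (Fin n) := ⟨⟨0, hn⟩⟩
  obtain ⟨X, hX, hmax⟩ := hΦ.exists_isMax hn hm
  have hX0 : X ≠ 0 := by rintro rfl; simpa using hX.trace_pos
  have hX' : (Φ X).PosDef := hΦ X hX.posSemidef hX0
  have hn' : (0 : ℝ) < n := by exact_mod_cast hn
  have hm' : (0 : ℝ) < m := by exact_mod_cast hm
  have hm𝕜 : (m : 𝕜) ≠ 0 := by exact_mod_cast hm.ne'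
  have hn𝕜 : (n : 𝕜) ≠ 0 := by exact_mod_cast hn.ne'
  have hXd := (isUnit_iff_isUnit_det X).mp hX.isUnit
  have hXd' := (isUnit_iff_isUnit_det _).mp hX'.isUnit
  -- Criticality says `Re Tr (D H) = 0` for every Hermitian `H`. As `D` is itself Hermitian, `H = D`
  -- gives `D = 0`.
  set D : Matrix (Fin n) (Fin n) 𝕜 := (m : ℝ) • X⁻¹ - (n : ℝ) • hsAdjoint Φ (Φ X)⁻¹ with hD
  have hadj : (hsAdjoint Φ (Φ X)⁻¹).IsHermitian := by
    rw [IsHermitian, conjTranspose_hsAdjoint hΦs, hX'.inv.1.eq]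
  have hDH : D.IsHermitian :=
    (isHermitian_real_smul hX.inv.1 _).sub (isHermitian_real_smul hadj _)
  have hcrit := re_trace_eq_of_isMax hX hX' hmax hDH
  have hadjD := hsInner_map_eq Φ D (Φ X)⁻¹
  rw [hsInner, hsInner, (hΦ.isHermitian_map hDH).eq, trace_mul_comm, hDH.eq,
    trace_mul_comm D] at hadjD
  rw [hadjD] at hcrit
  have htr : RCLike.re (Dᴴ * D).trace = 0 := by
    rw [hDH.eq]
    nth_rewrite 1 [hD]
    rw [Matrix.sub_mul, trace_sub, Matrix.smul_mul, Matrix.smul_mul, trace_smul, trace_smul,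
      map_sub, RCLike.smul_re, RCLike.smul_re, hcrit, sub_self]
  have hD0 : D = 0 := by
    rw [← trace_conjTranspose_mul_self_eq_zero_iff]
    have := RCLike.nonneg_iff.mp (posSemidef_conjTranspose_mul_self D).trace_nonneg
    exact RCLike.ext (by simpa using htr) (by simpa using this.2)
  have hEq : (m : 𝕜) • X⁻¹ = (n : 𝕜) • hsAdjoint Φ (Φ X)⁻¹ := by
    have := sub_eq_zero.mp hD0
    simpa [RCLike.real_smul_eq_coe_smul (K := 𝕜)] using this
  have hinvm : (0 : ℝ) < (m : ℝ)⁻¹ := inv_pos.mpr hm'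
  -- This choice of `φ₁` makes the first equation hold by construction; the second is the critical
  -- equation.
  refine ⟨X⁻¹, ((m : ℝ)⁻¹) • (Φ X)⁻¹, hX.inv, hX'.inv.smul hinvm, ?_, ?_⟩
  · rw [nonsing_inv_nonsing_inv X hXd, real_smul_inv hinvm hX'.inv, inv_inv,
      nonsing_inv_nonsing_inv _ hXd', RCLike.real_smul_eq_coe_smul (K := 𝕜), smul_smul]
    simp [hm𝕜]
  · rw [LinearMap.map_smul_of_tower, RCLike.real_smul_eq_coe_smul (K := 𝕜)]
    have : hsAdjoint Φ (Φ X)⁻¹ = (n : 𝕜)⁻¹ • (m : 𝕜) • X⁻¹ := by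
      rw [hEq, smul_smul, inv_mul_cancel₀ hn𝕜, one_smul]
    rw [this, smul_smul, smul_smul]
    congr 1
    push_cast
    field_simp

/-! ### Uniqueness: comparison in the Loewner order. -/

theorem IsScalingPair.smul {φ₀ : Matrix (Fin n) (Fin n) 𝕜} {φ₁ : Matrix (Fin m) (Fin m) 𝕜}
    (h : IsScalingPair Φ φ₀ φ₁) {c : ℝ} (hc : 0 < c) : IsScalingPair Φ (c • φ₀) (c • φ₁) := by
  obtain ⟨h₀, h₁, e₀, e₁⟩ := h
  refine ⟨h₀.smul hc, h₁.smul hc, ?_, ?_⟩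
  · rw [real_smul_inv hc h₀, real_smul_inv hc h₁, LinearMap.map_smul_of_tower, e₀, smul_comm]
  · rw [LinearMap.map_smul_of_tower, e₁, smul_comm]

/-- The largest `c` with `c • Y ≤ X`, for positive definite `X` and `Y`. -/
theorem exists_max_smul_le (hn : 0 < n) {X Y : Matrix (Fin n) (Fin n) 𝕜} (hX : X.PosDef)
    (hY : Y.PosDef) : ∃ c : ℝ, 0 < c ∧ (X - c • Y).PosSemidef ∧ ¬ (X - c • Y).PosDef := by
  have : Nonempty (Fin n) := ⟨⟨0, hn⟩⟩
  have hnear : ∀ {Z : Matrix (Fin n) (Fin n) 𝕜}, Z.PosDef → ∃ t : ℝ, 0 < t ∧ (Z - t • Y).PosDef := by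
    intro Z hZ
    have h := eventually_posDef_add_smul hZ hY.1.neg
    obtain ⟨t, h1, h2⟩ := ((h.filter_mono nhdsWithin_le_nhds).and
      (self_mem_nhdsWithin : Set.Ioi (0 : ℝ) ∈ 𝓝[>] 0)).exists
    exact ⟨t, h2, by simpa [sub_eq_add_neg] using h1⟩
  -- Comparing traces bounds `S`, and `S` is closed, so its supremum is attained. A definite
  -- difference there would leave room to increase it.
  set S : Set ℝ := {t | (X - t • Y).PosSemidef}
  have htr : 0 < RCLike.re Y.trace := (RCLike.pos_iff.mp hY.trace_pos).1
  have hbdd : BddAbove S := by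
    refine ⟨RCLike.re X.trace / RCLike.re Y.trace, fun t ht => ?_⟩
    have h := (RCLike.nonneg_iff.mp (PosSemidef.trace_nonneg ht)).1
    rw [trace_sub, trace_smul, map_sub, RCLike.smul_re] at h
    rw [le_div_iff₀ htr]
    linarith
  have hclosed : IsClosed S := by
    have : S = ⋂ x : Fin n → 𝕜, {t : ℝ | 0 ≤ RCLike.re (star x ⬝ᵥ ((X - t • Y) *ᵥ x))} := by
      ext t
      simp only [Set.mem_iInter, Set.mem_ofPred_eq, S]
      refine ⟨fun h x => h.re_dotProduct_nonneg x, fun h => ?_⟩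
      have hH : (X - t • Y).IsHermitian := hX.1.sub (isHermitian_real_smul hY.1 t)
      exact .of_dotProduct_mulVec_nonneg hH fun x =>
        RCLike.nonneg_iff.mpr ⟨h x, hH.im_star_dotProduct_mulVec_self x⟩
    rw [this]
    exact isClosed_iInter fun x => isClosed_le continuous_const (by fun_prop)
  obtain ⟨t₀, ht₀, hPD₀⟩ := hnear hX
  have ht₀S : t₀ ∈ S := hPD₀.posSemidef
  have hmem : sSup S ∈ S := hclosed.csSup_mem ⟨t₀, ht₀S⟩ hbdd
  refine ⟨sSup S, ht₀.trans_le (le_csSup hbdd ht₀S), hmem, fun hPD => ?_⟩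
  obtain ⟨t, ht, h⟩ := hnear hPD
  have : sSup S + t ∈ S := by
    change (X - (sSup S + t) • Y).PosSemidef
    rw [add_smul, ← sub_sub]
    exact h.posSemidef
  linarith [le_csSup hbdd this]

theorem posDef_of_one_div_smul {k l : ℕ} (hk : 0 < k) {A : Matrix (Fin l) (Fin l) 𝕜}
    (hA : ((1 / (k : 𝕜)) • A).PosDef) : A.PosDef := by
  have hk' : (0 : ℝ) < k := by exact_mod_cast hk
  have hk𝕜 : (k : 𝕜) ≠ 0 := by exact_mod_cast hk.ne'
  have h := hA.smul hk'
  rw [RCLike.real_smul_eq_coe_smul (K := 𝕜), smul_smul] at h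
  simpa [hk𝕜] using h

/-- A scaling pair with `ψ₀⁻¹ ≤ φ₀⁻¹` but not `ψ₀⁻¹ < φ₀⁻¹` coincides with `(φ₀, φ₁)`. -/
theorem IsScalingPair.eq_of_posSemidef (hΦ : StrictlyPositive Φ) (hΦs : ∀ X, Φ Xᴴ = (Φ X)ᴴ)
    (hn : 0 < n) (hm : 0 < m)
    {φ₀ ψ₀ : Matrix (Fin n) (Fin n) 𝕜} {φ₁ ψ₁ : Matrix (Fin m) (Fin m) 𝕜}
    (hφ : IsScalingPair Φ φ₀ φ₁) (hψ : IsScalingPair Φ ψ₀ ψ₁)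
    (hle : (φ₀⁻¹ - ψ₀⁻¹).PosSemidef) (hlt : ¬ (φ₀⁻¹ - ψ₀⁻¹).PosDef) : ψ₀ = φ₀ ∧ ψ₁ = φ₁ := by
  have : Nonempty (Fin m) := ⟨⟨0, hm⟩⟩
  obtain ⟨hφ₀, hφ₁, eφ₀, eφ₁⟩ := hφ
  obtain ⟨hψ₀, hψ₁, eψ₀, eψ₁⟩ := hψ
  have hm𝕜 : (1 / (m : 𝕜)) ≠ 0 := one_div_ne_zero (by exact_mod_cast hm.ne')
  have hunit : ∀ {l : ℕ} {A : Matrix (Fin l) (Fin l) 𝕜}, A.PosDef → A⁻¹⁻¹ = A := fun hA =>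
    nonsing_inv_nonsing_inv _ ((isUnit_iff_isUnit_det _).mp hA.isUnit)
  have heq : φ₀⁻¹ = ψ₀⁻¹ := by
    -- The difference stays definite along `φ₁⁻¹ - ψ₁⁻¹`, `ψ₁ - φ₁`, `ψ₀ - φ₀`, `φ₀⁻¹ - ψ₀⁻¹`, using
    -- in turn `Φ`, inversion, `Φ*`, inversion; the last contradicts `hlt`.
    by_contra hne
    have h1 := hΦ _ hle (sub_ne_zero.mpr hne)
    rw [map_sub, eφ₀, eψ₀, ← smul_sub] at h1
    have h2 := posDef_inv_sub_inv hψ₁.inv (posDef_of_one_div_smul hm h1)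
    rw [hunit hψ₁, hunit hφ₁] at h2
    have h3 := strictlyPositive_hsAdjoint hΦ hΦs _ h2.posSemidef
      (fun h0 => by simpa [h0] using h2.trace_pos)
    rw [map_sub, eφ₁, eψ₁, ← smul_sub] at h3
    exact hlt (posDef_inv_sub_inv hφ₀ (posDef_of_one_div_smul hn h3))
  refine ⟨by rw [← hunit hψ₀, ← heq, hunit hφ₀], ?_⟩
  rw [heq, eψ₀] at eφ₀
  rw [← hunit hψ₁, smul_right_injective _ hm𝕜 eφ₀, hunit hφ₁]

/-- Scaling pairs are unique up to a common positive constant. -/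
theorem IsScalingPair.exists_eq_smul (hΦ : StrictlyPositive Φ) (hΦs : ∀ X, Φ Xᴴ = (Φ X)ᴴ)
    (hn : 0 < n) (hm : 0 < m)
    {φ₀ ψ₀ : Matrix (Fin n) (Fin n) 𝕜} {φ₁ ψ₁ : Matrix (Fin m) (Fin m) 𝕜}
    (hφ : IsScalingPair Φ φ₀ φ₁) (hψ : IsScalingPair Φ ψ₀ ψ₁) :
    ∃ c : ℝ, 0 < c ∧ ψ₀ = c • φ₀ ∧ ψ₁ = c • φ₁ := by
  obtain ⟨c, hc, hle, hlt⟩ := exists_max_smul_le hn hφ.1.inv hψ.1.inv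
  -- The constant is absorbed into the pair: `(c⁻¹ ψ₀, c⁻¹ ψ₁)` is again a scaling pair and touches
  -- `(φ₀, φ₁)` as the comparison lemma requires.
  have hinv : (c⁻¹ • ψ₀)⁻¹ = c • ψ₀⁻¹ := by
    rw [real_smul_inv (inv_pos.mpr hc) hψ.1, inv_inv]
  rw [← hinv] at hle hlt
  obtain ⟨h₀, h₁⟩ :=
    hφ.eq_of_posSemidef hΦ hΦs hn hm (hψ.smul (inv_pos.mpr hc)) hle hlt
  refine ⟨c, hc, ?_, ?_⟩
  · rw [← h₀, smul_inv_smul₀ hc.ne']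
  · rw [← h₁, smul_inv_smul₀ hc.ne']

/-- Existence and uniqueness of the scaling pair over either field. -/
theorem StrictlyPositive.exists_isScalingPair_iff (hΦ : StrictlyPositive Φ)
    (hΦs : ∀ X, Φ Xᴴ = (Φ X)ᴴ) (hn : 0 < n) (hm : 0 < m) :
    ∃ (φ₀ : Matrix (Fin n) (Fin n) 𝕜) (φ₁ : Matrix (Fin m) (Fin m) 𝕜),
      IsScalingPair Φ φ₀ φ₁ ∧
      ∀ (ψ₀ : Matrix (Fin n) (Fin n) 𝕜) (ψ₁ : Matrix (Fin m) (Fin m) 𝕜),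
        IsScalingPair Φ ψ₀ ψ₁ ↔ ∃ c : ℝ, 0 < c ∧ ψ₀ = c • φ₀ ∧ ψ₁ = c • φ₁ := by
  obtain ⟨φ₀, φ₁, hφ⟩ := hΦ.exists_isScalingPair hΦs hn hm
  refine ⟨φ₀, φ₁, hφ, fun ψ₀ ψ₁ => ⟨hφ.exists_eq_smul hΦ hΦs hn hm, ?_⟩⟩
  rintro ⟨c, hc, rfl, rfl⟩
  exact hφ.smul hc

/-- Over `ℂ`, strictly positive maps automatically commute with the conjugate transpose. -/
theorem StrictlyPositive.map_conjTranspose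
    {Φ : Matrix (Fin n) (Fin n) ℂ →ₗ[ℂ] Matrix (Fin m) (Fin m) ℂ} (hΦ : StrictlyPositive Φ)
    (X : Matrix (Fin n) (Fin n) ℂ) : Φ Xᴴ = (Φ X)ᴴ := by
  have hA : (realPart X : Matrix (Fin n) (Fin n) ℂ).IsHermitian := (realPart X).2
  have hB : (imaginaryPart X : Matrix (Fin n) (Fin n) ℂ).IsHermitian := (imaginaryPart X).2
  rw [← realPart_add_I_smul_imaginaryPart X]
  simp only [map_add, map_smul, conjTranspose_add, conjTranspose_smul, hA.eq, hB.eq,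
    (hΦ.isHermitian_map hA).eq, (hΦ.isHermitian_map hB).eq]

end Scaling

end OperatorScaling

theorem mainTheorem2 (n m : ℕ) (hn : 0 < n) (hm : 0 < m) :
    (∀ Φ : Matrix (Fin n) (Fin n) ℂ →ₗ[ℂ] Matrix (Fin m) (Fin m) ℂ,
      OperatorScaling.StrictlyPositive Φ →
      ∃ (φ₀ : Matrix (Fin n) (Fin n) ℂ) (φ₁ : Matrix (Fin m) (Fin m) ℂ),
        OperatorScaling.IsScalingPair Φ φ₀ φ₁ ∧
        ∀ (ψ₀ : Matrix (Fin n) (Fin n) ℂ) (ψ₁ : Matrix (Fin m) (Fin m) ℂ),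
          OperatorScaling.IsScalingPair Φ ψ₀ ψ₁ ↔
            ∃ c : ℝ, 0 < c ∧ ψ₀ = c • φ₀ ∧ ψ₁ = c • φ₁) ∧
    (∀ Φ : Matrix (Fin n) (Fin n) ℝ →ₗ[ℝ] Matrix (Fin m) (Fin m) ℝ,
      OperatorScaling.StrictlyPositive Φ →
      (∀ X : Matrix (Fin n) (Fin n) ℝ, Φ X.transpose = (Φ X).transpose) →
      ∃ (φ₀ : Matrix (Fin n) (Fin n) ℝ) (φ₁ : Matrix (Fin m) (Fin m) ℝ),
        OperatorScaling.IsScalingPair Φ φ₀ φ₁ ∧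
        ∀ (ψ₀ : Matrix (Fin n) (Fin n) ℝ) (ψ₁ : Matrix (Fin m) (Fin m) ℝ),
          OperatorScaling.IsScalingPair Φ ψ₀ ψ₁ ↔
            ∃ c : ℝ, 0 < c ∧ ψ₀ = c • φ₀ ∧ ψ₁ = c • φ₁) := by
  refine ⟨fun Φ hΦ => hΦ.exists_isScalingPair_iff hΦ.map_conjTranspose hn hm,
    fun Φ hΦ hΦt => hΦ.exists_isScalingPair_iff (fun X => ?_) hn hm⟩
  simpa [Matrix.conjTranspose_eq_transpose_of_trivial] using hΦt X
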